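/- Let $\mathcal X\subset\mathbb R^m$ be compact, $q:\mathcal X\to[0,\infty)$ a base density and $t:\mathcal X\to\mathbb R^d$ a continuous statistic. For $\lambda\in\mathbb R^d$ with $Z(\lambda)=\int_{\mathcal X}q(x)e^{\langle\lambda,t(x)\rangle}dx<\infty$ put $f(x\mid\lambda)=q(x)e^{\langle\lambda,t(x)\rangle}/Z(\lambda)$. Assume the family is minimal: if $\langle a,t(x)\rangle$ is constant for almost every $x$ with respect to $q(x)\,dx$, then $a=0$. Let $C$ be a set of parameters $\lambda$ with $Z(\lambda)<\infty$ such that $\{f(\cdot\mid\lambda):\lambda\in C\}$ is uniformly equicontinuous on $\mathcal X$, and let $\Theta\subseteq\mathbb R^d$ be closed with $C\subseteq\Theta$ (for instance $\Theta=\mathbb R^d$, or $\Theta=C$ if $C$ is closed). Let $K:\mathbb R^m\to[0,\infty)$ be a bounded probability density of bounded variation (for $m\ge2$ in the sense of Hardy and Krause: the Vitali variations of all coordinate sections of $K$, of all dimensions $1,\dots,m$, have a common bound). Let $H_n=h_n^2I_m$ with $h_n>0$, so $|H_n|=\det H_n=h_n^{2m}$, be bandwidths with $\sum_{n\ge1}e^{-\gamma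 n|H_n|}<\infty$ for every $\gamma>0$, and let $K_{H}(x;y)=|H|^{-1/2}K(H^{-1/2}(x-y))$. Fix $\beta>0$. Let $x^1,x^2,\dots$ be i.i.d. random vectors with density $f(\cdot\mid\lambda)$ on $\mathcal X$, where $\lambda\in C$. For $\theta=(\lambda',\lambda_a)\in\Theta\times\mathbb R^n$ let $$S_\theta(x)=\langle\lambda',t(x)\rangle+\sum_{i=1}^n\lambda_a^i K_{H_n}(x^i;x),\qquad \ell_n(\theta)=\frac1n\sum_{j=1}^n S_\theta(x^j)-\ln\int_{\mathcal X}q(x)e^{S_\theta(x)}dx-\beta\sum_{i=1}^n|\lambda_a^i|,$$ the $\ell_1$-penalized log-likelihood of the non-parametric exponential family. Let $\hat\theta_n=(\tilde\lambda_n,\tilde\lambda_{a,n})$ be a maximizer of $\ell_n$ over $\Theta\times\mathbb R^n$ whenever a maximizer exists (and arbitrary otherwise). Then, as $n\to\infty$, the augmented parameters converge to $0$ in probability, simultaneously in $i$, that is $P\big(\max_{1\le i\le n}|\tilde\lambda_{a,n}^i|\ge\varepsilon\big)\to0$ for every $\varepsilon>0$, and the canonical parameters converge to the true ones, $\tilde\lambda_n\to\lambda$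 in probability. -/

import Mathlib

open MeasureTheory ProbabilityTheory Filter Topology

namespace NPEF

noncomputable section

/-- The space `ℝᵏ` with its Euclidean inner product and Lebesgue measure. -/
abbrev E (k : ℕ) : Type := EuclideanSpace ℝ (Fin k)

/-! ### The exponential family -/

/-- Partition function `Z(lam) = ∫_X q(x) exp⟨lam, t(x)⟩ dx`. -/
def partitionEF {m d : ℕ} (X : Set (E m)) (q : E m → ℝ) (t : E m → E d) (lam : E d) : ℝ :=
  ∫ x in X, q x * Real.exp (inner ℝ lam (t x))

/-- The canonical parameters whose partition function is finite. -/
def canonicalSpace {m d : ℕ} (X : Set (E m)) (q : E m → ℝ) (t : E m → E d) : Set (E d) :=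
  {lam | IntegrableOn (fun x => q x * Real.exp (inner ℝ lam (t x))) X}

/-- The density `f(x | lam) = q(x) exp⟨lam, t(x)⟩ / Z(lam)` on `X`. -/
def densityEF {m d : ℕ} (X : Set (E m)) (q : E m → ℝ) (t : E m → E d) (lam : E d) (x : E m) : ℝ :=
  q x * Real.exp (inner ℝ lam (t x)) / partitionEF X q t lam

/-- The distribution on `X` with density `f(· | lam)` with respect to Lebesgue measure. -/
def lawEF {m d : ℕ} (X : Set (E m)) (q : E m → ℝ) (t : E m → E d) (lam : E d) : Measure (E m) :=
  (volume.restrict X).withDensity (fun x => ENNReal.ofReal (densityEF X q t lam x))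

/-- Minimality of the family: no nontrivial linear combination of the statistics is constant
almost everywhere with respect to the base measure `q(x) dx` on `X`. -/
def IsMinimal {m d : ℕ} (X : Set (E m)) (q : E m → ℝ) (t : E m → E d) : Prop :=
  ∀ a : E d,
    (∃ c : ℝ, ∀ᵐ x ∂((volume.restrict X).withDensity (fun x => ENNReal.ofReal (q x))),
      inner ℝ a (t x) = c) → a = 0

/-! ### Kernels -/

/-- The `J`-dimensional increment of `g` over the box between the corners `a` and `b`:
the alternating sum of `g` over the vertices obtained by letting the coordinates in `J` take the
value `a j` or `b j`, while the coordinates outside `J` stay frozen at `a j`. -/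
def boxIncrement {m : ℕ} (g : E m → ℝ) (J : Finset (Fin m)) (a b : Fin m → ℝ) : ℝ :=
  ∑ S ∈ J.powerset,
    (-1 : ℝ) ^ (J \ S).card * g (WithLp.toLp 2 (fun j => if j ∈ S then b j else a j))

/-- Bounded variation on `ℝᵐ` in the sense of Hardy and Krause: there is a common bound for the
Vitali variations of all sections of `g` of all dimensions `1, …, m`. A section lets the
coordinates in `J` vary and freezes every other coordinate `j` at `s j 0`; its variation is
the supremum over all finite grids of the sum of the absolute increments over the grid cells.
For `m = 1` this is the usual bounded variation on `ℝ`. -/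
def HasBoundedVariation {m : ℕ} (g : E m → ℝ) : Prop :=
  ∃ V : ℝ, ∀ J : Finset (Fin m), J.Nonempty → ∀ s : Fin m → ℕ → ℝ, (∀ j, Monotone (s j)) →
    ∀ N : ℕ,
      ∑ i ∈ Fintype.piFinset (fun j => if j ∈ J then Finset.range N else {0}),
        |boxIncrement g J (fun j => s j (i j)) (fun j => s j (i j + 1))| ≤ V

/-- A kernel: a bounded probability density function. -/
structure IsKernel {m : ℕ} (K : E m → ℝ) : Prop where
  measurable : Measurable K
  nonneg : ∀ u, 0 ≤ K u
  bounded : ∃ B : ℝ, ∀ u, K u ≤ B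
  integrable : Integrable K
  integral_eq_one : ∫ u, K u = 1

/-- Determinant `|H|` of the bandwidth matrix `H = h² I_m`. -/
def detH (m : ℕ) (h : ℝ) : ℝ := ((h ^ 2) • (1 : Matrix (Fin m) (Fin m) ℝ)).det

/-- `K_H(x ; y) = |H|^(-1/2) K(H^(-1/2) (x - y))` for `H = h² I_m`, `h > 0`. -/
def scaledKernel {m : ℕ} (K : E m → ℝ) (h : ℝ) (x y : E m) : ℝ :=
  (Real.sqrt (detH m h))⁻¹ * K (h⁻¹ • (x - y))

/-! ### The non-parametric exponential family -/

/-- `⟨lam, t(x)⟩ + ⟨lamₐ, tₐ(x)⟩`, with augmented statistics `tₐⁱ(x) = K_H(xⁱ ; x)` centred at the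
data points `xs 0, …, xs (n - 1)`; here `θ = (lam, lamₐ)`. -/
def augmentedExponent {m d n : ℕ} (t : E m → E d) (K : E m → ℝ) (h : ℝ) (xs : Fin n → E m)
    (θ : E d × (Fin n → ℝ)) (x : E m) : ℝ :=
  inner ℝ θ.1 (t x) + ∑ i, θ.2 i * scaledKernel K h (xs i) x

/-- Partition function of the augmented model. -/
def partitionNEF {m d n : ℕ} (X : Set (E m)) (q : E m → ℝ) (t : E m → E d) (K : E m → ℝ)
    (h : ℝ) (xs : Fin n → E m) (θ : E d × (Fin n → ℝ)) : ℝ :=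
  ∫ x in X, q x * Real.exp (augmentedExponent t K h xs θ x)

/-- The `ℓ₁`-penalized average log-likelihood
`⟨θ, (1/n) ∑ⱼ s(xʲ)⟩ - ln Z(θ) - ∑ᵢ β |lamₐⁱ|`. -/
def penalizedLogLik {m d n : ℕ} (X : Set (E m)) (q : E m → ℝ) (t : E m → E d) (K : E m → ℝ)
    (h β : ℝ) (xs : Fin n → E m) (θ : E d × (Fin n → ℝ)) : ℝ :=
  (n : ℝ)⁻¹ * ∑ j, augmentedExponent t K h xs θ (xs j)
    - Real.log (partitionNEF X q t K h xs θ) - ∑ i, β * |θ.2 i|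

/-- `θ` maximizes the penalized log-likelihood over all `(lam, lamₐ)` with `lam ∈ Θ` and
`lamₐ ∈ ℝⁿ`. -/
def IsPenalizedMLE {m d n : ℕ} (X : Set (E m)) (q : E m → ℝ) (t : E m → E d) (K : E m → ℝ)
    (h β : ℝ) (Θ : Set (E d)) (xs : Fin n → E m) (θ : E d × (Fin n → ℝ)) : Prop :=
  θ.1 ∈ Θ ∧ ∀ θ' : E d × (Fin n → ℝ), θ'.1 ∈ Θ →
    penalizedLogLik X q t K h β xs θ' ≤ penalizedLogLik X q t K h β xs θ

end

end NPEF

/-!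
With probability tending to one the penalized log-likelihood has maximizers, and every maximizer
has augmented part exactly zero and canonical part close to the true parameter `lam`. All
likelihoods are compared with that of `(lam, 0)`: up to a constant, the penalized log-likelihood is
`excessLogLik`, in which the partition function is the moment generating function of the statistics
under the true law `μ`.

*Deterministic part.* Suppose that at each sample point the kernel average is within `β / 4` of its
`μ`-mean, and that the sample mean of `t` is close to its `μ`-mean. For `‖u‖ ≤ δ`, Jensen's
inequality under the law tilted by `⟨u, t⟩` bounds the gain from the augmented statistics by
`β / 2` times the `ℓ₁` norm of their coefficients, so the penalty makes zero coefficients optimal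
(`excessLogLik_add_le`). On the sphere `‖u‖ = δ` the log-likelihood ratio is negative, by minimality
and compactness (`exists_excessLogLik_neg_on_sphere`). Concavity carries this to all parameters
beyond the sphere (`excessLogLik_neg_of_lt_norm`), even along segments that leave `Θ`. What is left
is the maximization of a continuous function on a compact subset of `Θ`
(`excessLogLik_maximizers`).

*Probabilistic part.* The sample mean of `t` is handled by the law of large numbers. Only the
values of the kernel averages at the `n` sample points enter the likelihood, so a union bound over
these points, each time freezing the centre of the kernel, replaces a bound uniform over the space
(`measure_exists_kernel_deviation_le`). Equicontinuity makes the true density bounded, so a scaled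
kernel bounded by `b` has variance `O(b)` rather than `O(b²)`, and Bernstein's inequality gives
tails `exp (-c n / b)`. Summability of `exp (-γ n |H_n|)` gives `n |H_n| → ∞`, hence
`b = O(|H_n| ^ (-1/2)) = O(√n)`, and `n exp (-c √n) → 0`. The total variation of the kernel does
not enter.
-/

namespace NPEF

/-! ### Log-partition functions of bounded exponents -/

section LogPartition

variable {S : Type*} [MeasurableSpace S] {μ : Measure S}

lemma exists_ae_abs_le_of_memLp_top {g : S → ℝ} (hg : MemLp g ⊤ μ) :
    ∃ b : ℝ, ∀ᵐ x ∂μ, |g x| ≤ b := by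
  refine ⟨(eLpNorm g ⊤ μ).toReal, ?_⟩
  filter_upwards [ae_le_eLpNormEssSup (f := g) (μ := μ)] with x hx
  have h2 := hg.eLpNorm_lt_top
  rw [eLpNorm_exponent_top] at h2 ⊢
  have h1 := ENNReal.toReal_mono h2.ne hx
  simpa using h1

lemma memLp_top_exp {g : S → ℝ} (hg : MemLp g ⊤ μ) :
    MemLp (fun x => Real.exp (g x)) ⊤ μ := by
  obtain ⟨b, hb⟩ := exists_ae_abs_le_of_memLp_top hg
  refine memLp_top_of_bound (Real.continuous_exp.comp_aestronglyMeasurable hg.1) (Real.exp b) ?_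
  filter_upwards [hb] with x hx
  rw [Real.norm_eq_abs, Real.abs_exp]
  exact Real.exp_le_exp.2 ((le_abs_self _).trans hx)

lemma memLp_top_mul {f g : S → ℝ} (hf : MemLp f ⊤ μ) (hg : MemLp g ⊤ μ) :
    MemLp (fun x => f x * g x) ⊤ μ := hg.mul' hf

variable [IsProbabilityMeasure μ]

lemma integral_exp_pos_of_memLp_top {g : S → ℝ} (hg : MemLp g ⊤ μ) :
    0 < ∫ x, Real.exp (g x) ∂μ :=
  integral_exp_pos ((memLp_top_exp hg).integrable le_top)

/-- Jensen's inequality under the tilted measure with density proportional to `exp w`. -/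
lemma log_integral_exp_add_ge {w g : S → ℝ} (hw : MemLp w ⊤ μ) (hg : MemLp g ⊤ μ) :
    Real.log (∫ x, Real.exp (w x) ∂μ)
        + (∫ x, g x * Real.exp (w x) ∂μ) / (∫ x, Real.exp (w x) ∂μ)
      ≤ Real.log (∫ x, Real.exp (w x + g x) ∂μ) := by
  set W := ∫ x, Real.exp (w x) ∂μ with hW
  have hWpos : 0 < W := integral_exp_pos_of_memLp_top hw
  set c := (∫ x, g x * Real.exp (w x) ∂μ) / W with hc
  have hwg : MemLp (fun x => w x + g x) ⊤ μ := hw.add hg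
  have i1 : Integrable (fun x => Real.exp (w x)) μ := (memLp_top_exp hw).integrable le_top
  have i2 : Integrable (fun x => g x * Real.exp (w x)) μ :=
    (memLp_top_mul hg (memLp_top_exp hw)).integrable le_top
  have i3 : Integrable (fun x => Real.exp (w x + g x)) μ := (memLp_top_exp hwg).integrable le_top
  have key : W ≤ Real.exp (-c) * ∫ x, Real.exp (w x + g x) ∂μ := by
    have e1 : ∫ x, (g x * Real.exp (w x) + (1 - c) * Real.exp (w x)) ∂μ = W := by
      rw [integral_add i2 (i1.const_mul _), integral_const_mul, ← hW]
      have : ∫ x, g x * Real.exp (w x) ∂μ = c * W := by rw [hc]; field_simp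
      rw [this]; ring
    rw [← e1, ← integral_const_mul]
    refine integral_mono (i2.add (i1.const_mul _)) (i3.const_mul _) fun x => ?_
    have h1 := Real.add_one_le_exp (g x - c)
    have h2 : Real.exp (-c) * Real.exp (w x + g x) = Real.exp (g x - c) * Real.exp (w x) := by
      rw [← Real.exp_add, ← Real.exp_add]; congr 1; ring
    simp only [h2]
    nlinarith [Real.exp_pos (w x)]
  have hlog := Real.log_le_log hWpos key
  rw [Real.log_mul (Real.exp_pos _).ne' (integral_exp_pos_of_memLp_top hwg).ne',
    Real.log_exp] at hlog
  linarith

/-- Convexity of the log-partition function along a segment issuing from the zero exponent. -/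
lemma log_integral_exp_mul_le {g : S → ℝ} (hg : MemLp g ⊤ μ) {s : ℝ} (hs0 : 0 ≤ s) (hs1 : s ≤ 1) :
    Real.log (∫ x, Real.exp (s * g x) ∂μ) ≤ s * Real.log (∫ x, Real.exp (g x) ∂μ) := by
  have hpos := integral_exp_pos_of_memLp_top hg
  set c := Real.log (∫ x, Real.exp (g x) ∂μ) with hc
  have hexp : Real.exp c = ∫ x, Real.exp (g x) ∂μ := Real.exp_log hpos
  have hsg : MemLp (fun x => s * g x) ⊤ μ := hg.const_mul s
  have i1 : Integrable (fun x => Real.exp (g x)) μ := (memLp_top_exp hg).integrable le_top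
  have i2 : Integrable (fun x => Real.exp (s * g x)) μ := (memLp_top_exp hsg).integrable le_top
  have key : Real.exp (-(s * c)) * ∫ x, Real.exp (s * g x) ∂μ ≤ 1 := by
    have e1 : ∫ x, (s * (Real.exp (-c) * Real.exp (g x)) + (1 - s)) ∂μ = 1 := by
      rw [integral_add ((i1.const_mul _).const_mul _) (integrable_const _), integral_const_mul,
        integral_const_mul, ← hexp, ← Real.exp_add]
      simp
    rw [← e1, ← integral_const_mul]
    refine integral_mono (i2.const_mul _)
      (((i1.const_mul _).const_mul _).add (integrable_const _)) fun x => ?_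
    have h := convexOn_exp.2 (Set.mem_univ (g x - c)) (Set.mem_univ 0) hs0 (sub_nonneg.2 hs1)
      (by ring)
    simp only [smul_eq_mul, mul_zero, add_zero, Real.exp_zero, mul_one] at h
    have h2 : Real.exp (-(s * c)) * Real.exp (s * g x) = Real.exp (s * (g x - c)) := by
      rw [← Real.exp_add]; congr 1; ring
    have h3 : Real.exp (-c) * Real.exp (g x) = Real.exp (g x - c) := by
      rw [← Real.exp_add]; congr 1; ring
    simp only [h2, h3]
    exact h
  have hlog := Real.log_le_log
    (mul_pos (Real.exp_pos _) (integral_exp_pos_of_memLp_top hsg)) key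
  rw [Real.log_mul (Real.exp_pos _).ne' (integral_exp_pos_of_memLp_top hsg).ne',
    Real.log_exp, Real.log_one] at hlog
  linarith

lemma log_integral_exp_le_add {f g : S → ℝ} (hf : MemLp f ⊤ μ) (hg : MemLp g ⊤ μ) {c : ℝ}
    (hfg : ∀ᵐ x ∂μ, f x ≤ g x + c) :
    Real.log (∫ x, Real.exp (f x) ∂μ) ≤ Real.log (∫ x, Real.exp (g x) ∂μ) + c := by
  have i1 : Integrable (fun x => Real.exp (f x)) μ := (memLp_top_exp hf).integrable le_top
  have i2 : Integrable (fun x => Real.exp (g x)) μ := (memLp_top_exp hg).integrable le_top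
  have key : ∫ x, Real.exp (f x) ∂μ ≤ Real.exp c * ∫ x, Real.exp (g x) ∂μ := by
    rw [← integral_const_mul]
    refine integral_mono_ae i1 (i2.const_mul _) ?_
    filter_upwards [hfg] with x hx
    rw [← Real.exp_add]
    exact Real.exp_le_exp.2 (by linarith)
  have hlog := Real.log_le_log (integral_exp_pos_of_memLp_top hf) key
  rw [Real.log_mul (Real.exp_pos _).ne' (integral_exp_pos_of_memLp_top hg).ne',
    Real.log_exp] at hlog
  linarith

/-- The equality case of Jensen's inequality for the exponential. -/
lemma ae_eq_integral_of_log_integral_exp_le {g : S → ℝ} (hg : MemLp g ⊤ μ)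
    (h : Real.log (∫ x, Real.exp (g x) ∂μ) ≤ ∫ x, g x ∂μ) :
    ∀ᵐ x ∂μ, g x = ∫ y, g y ∂μ := by
  set c := ∫ y, g y ∂μ with hc
  have i0 : Integrable g μ := hg.integrable le_top
  have i1 : Integrable (fun x => Real.exp (g x)) μ := (memLp_top_exp hg).integrable le_top
  have hle : ∫ x, Real.exp (g x) ∂μ ≤ Real.exp c :=
    (Real.log_le_iff_le_exp (integral_exp_pos_of_memLp_top hg)).1 h
  have hnn : ∀ x, 0 ≤ Real.exp (-c) * Real.exp (g x) - (g x - c + 1) := fun x => by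
    rw [← Real.exp_add]
    have := Real.add_one_le_exp (-c + g x)
    linarith
  have i3 : Integrable (fun x => g x - c) μ := i0.sub (integrable_const c)
  have i2 : Integrable (fun x => g x - c + 1) μ := i3.add (integrable_const 1)
  have hc1 : ∫ x, (g x - c + 1) ∂μ = 1 := by
    rw [integral_add i3 (integrable_const 1), integral_sub i0 (integrable_const c)]
    simp [hc]
  have hI : Integrable (fun x => Real.exp (-c) * Real.exp (g x) - (g x - c + 1)) μ :=
    (i1.const_mul _).sub i2
  have hint : ∫ x, (Real.exp (-c) * Real.exp (g x) - (g x - c + 1)) ∂μ ≤ 0 := by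
    rw [integral_sub (i1.const_mul _) i2, integral_const_mul, hc1]
    have h1 : Real.exp (-c) * ∫ x, Real.exp (g x) ∂μ ≤ 1 := by
      calc _ ≤ Real.exp (-c) * Real.exp c := by gcongr
        _ = 1 := by rw [← Real.exp_add]; simp
    linarith
  have h0 := (integral_eq_zero_iff_of_nonneg hnn hI).1
    (le_antisymm hint (integral_nonneg hnn))
  filter_upwards [h0] with x hx
  by_contra hne
  have h1 := Real.add_one_lt_exp (sub_ne_zero.2 hne)
  have h2 : Real.exp (-c) * Real.exp (g x) = Real.exp (g x - c) := by
    rw [← Real.exp_add]; congr 1; ring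
  simp only [h2, Pi.zero_apply] at hx
  linarith

/-- Tilting by a bounded exponent `w` with `|w| ≤ r` changes the mean of a nonnegative function
by a factor between `exp (-2r)` and `exp (2r)`. -/
lemma abs_tilted_mean_sub_mean_le {w g : S → ℝ} (hw : MemLp w ⊤ μ) (hg : MemLp g ⊤ μ) {r : ℝ}
    (hr : ∀ᵐ x ∂μ, |w x| ≤ r) (hg0 : ∀ᵐ x ∂μ, 0 ≤ g x) :
    |(∫ x, g x * Real.exp (w x) ∂μ) / (∫ x, Real.exp (w x) ∂μ) - ∫ x, g x ∂μ|
      ≤ (Real.exp (2 * r) - 1) * ∫ x, g x ∂μ := by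
  have i0 : Integrable g μ := hg.integrable le_top
  have i1 : Integrable (fun x => Real.exp (w x)) μ := (memLp_top_exp hw).integrable le_top
  have i2 : Integrable (fun x => g x * Real.exp (w x)) μ :=
    (memLp_top_mul hg (memLp_top_exp hw)).integrable le_top
  have hWpos := integral_exp_pos_of_memLp_top hw
  set W := ∫ x, Real.exp (w x) ∂μ with hW
  have hWle : W ≤ Real.exp r := by
    have := integral_mono_ae i1 (integrable_const (Real.exp r))
      (hr.mono fun x hx => Real.exp_le_exp.2 (le_of_abs_le hx))
    simpa using this
  have hWge : Real.exp (-r) ≤ W := by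
    have := integral_mono_ae (integrable_const (Real.exp (-r))) i1
      (hr.mono fun x hx => Real.exp_le_exp.2 (neg_le_of_abs_le hx))
    simpa using this
  have hg0' : 0 ≤ ∫ x, g x ∂μ := integral_nonneg_of_ae hg0
  have hup : ∫ x, g x * Real.exp (w x) ∂μ ≤ Real.exp r * ∫ x, g x ∂μ := by
    rw [← integral_const_mul]
    refine integral_mono_ae i2 (i0.const_mul _) ?_
    filter_upwards [hr, hg0] with x hx hx0
    rw [mul_comm]
    exact mul_le_mul_of_nonneg_right (Real.exp_le_exp.2 (le_of_abs_le hx)) hx0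
  have hlo : Real.exp (-r) * ∫ x, g x ∂μ ≤ ∫ x, g x * Real.exp (w x) ∂μ := by
    rw [← integral_const_mul]
    refine integral_mono_ae (i0.const_mul _) i2 ?_
    filter_upwards [hr, hg0] with x hx hx0
    rw [mul_comm (g x)]
    exact mul_le_mul_of_nonneg_right (Real.exp_le_exp.2 (neg_le_of_abs_le hx)) hx0
  set G := ∫ x, g x ∂μ with hG
  set A := ∫ x, g x * Real.exp (w x) ∂μ with hA
  have h1 : A / W ≤ Real.exp (2 * r) * G := by
    rw [div_le_iff₀ hWpos]
    calc A ≤ Real.exp r * G := hup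
      _ = Real.exp (2 * r) * G * Real.exp (-r) := by
          rw [mul_right_comm, ← Real.exp_add]; congr 2; ring
      _ ≤ _ := by gcongr
  have h2 : Real.exp (-(2 * r)) * G ≤ A / W := by
    rw [le_div_iff₀ hWpos]
    calc _ ≤ Real.exp (-(2 * r)) * G * Real.exp r := by gcongr
      _ = Real.exp (-r) * G := by rw [mul_right_comm, ← Real.exp_add]; congr 2; ring
      _ ≤ A := hlo
  -- `1 - exp (-2r) ≤ exp (2r) - 1` because `exp y + exp (-y) ≥ 2`
  have h3 : 2 ≤ Real.exp (2 * r) + Real.exp (-(2 * r)) := by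
    have := Real.add_one_le_exp (2 * r)
    have := Real.add_one_le_exp (-(2 * r))
    linarith
  rw [abs_le]
  constructor <;> nlinarith

end LogPartition

/-! ### Maximizers of the penalized log-likelihood -/

section Excess

variable {S V ι : Type*} [MeasurableSpace S] [NormedAddCommGroup V] [InnerProductSpace ℝ V]
  [Fintype ι]

/-- The penalized log-likelihood ratio of the parameter `(u, a)`, measured from the true parameter:
`μ` is the true law, `T` the canonical and `k` the augmented statistics, and `τ`, `κ` are their
sample means. It vanishes at `(0, 0)`. -/
noncomputable def excessLogLik (μ : Measure S) (T : S → V) (k : ι → S → ℝ) (β : ℝ) (τ : V)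
    (κ : ι → ℝ) (u : V) (a : ι → ℝ) : ℝ :=
  inner ℝ u τ + ∑ i, a i * κ i
    - Real.log (∫ x, Real.exp (inner ℝ u (T x) + ∑ i, a i * k i x) ∂μ) - ∑ i, β * |a i|

variable {μ : Measure S} {T : S → V} {k : ι → S → ℝ} {β : ℝ} {τ : V} {κ : ι → ℝ}

lemma memLp_top_inner (hT : MemLp T ⊤ μ) (u : V) : MemLp (fun x => inner ℝ u (T x)) ⊤ μ :=
  hT.const_inner u

lemma memLp_top_linear_combination (hk : ∀ i, MemLp (k i) ⊤ μ) (a : ι → ℝ) :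
    MemLp (fun x => ∑ i, a i * k i x) ⊤ μ :=
  memLp_finsetSum _ fun i _ => (hk i).const_mul (a i)

lemma abs_inner_le_of_ae_norm_le {B : ℝ} (hB : ∀ᵐ x ∂μ, ‖T x‖ ≤ B) {δ : ℝ} {u : V}
    (hu : ‖u‖ ≤ δ) : ∀ᵐ x ∂μ, |inner ℝ u (T x)| ≤ δ * B := by
  filter_upwards [hB] with x hx
  exact (abs_real_inner_le_norm _ _).trans
    (mul_le_mul hu hx (norm_nonneg _) ((norm_nonneg _).trans hu))

variable [IsProbabilityMeasure μ]

/-- Near the true parameter the `ℓ₁` penalty dominates the gain from the augmented statistics: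
by Jensen's inequality that gain is at most linear, with slopes the differences between the sample
means `κ i` and the means of `k i` under the tilted law. -/
lemma excessLogLik_add_le (hT : MemLp T ⊤ μ) {B : ℝ} (hB : ∀ᵐ x ∂μ, ‖T x‖ ≤ B)
    (hk : ∀ i, MemLp (k i) ⊤ μ) (hk0 : ∀ i, ∀ᵐ x ∂μ, 0 ≤ k i x) {F : ℝ}
    (hF : ∀ i, ∫ x, k i x ∂μ ≤ F) {δ : ℝ} (hδ : 0 ≤ δ * B)
    (hδF : (Real.exp (2 * (δ * B)) - 1) * F ≤ β / 4)
    (hκ : ∀ i, |κ i - ∫ x, k i x ∂μ| ≤ β / 4) {u : V} (hu : ‖u‖ ≤ δ) (a : ι → ℝ) :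
    excessLogLik μ T k β τ κ u a + β / 2 * ∑ i, |a i| ≤ excessLogLik μ T k β τ κ u 0 := by
  have hw := memLp_top_inner hT u
  have hg := memLp_top_linear_combination hk a
  have hJ := log_integral_exp_add_ge hw hg
  set W := ∫ x, Real.exp (inner ℝ u (T x)) ∂μ with hW
  have hlin : (∫ x, (∑ i, a i * k i x) * Real.exp (inner ℝ u (T x)) ∂μ) / W
      = ∑ i, a i * ((∫ x, k i x * Real.exp (inner ℝ u (T x)) ∂μ) / W) := by
    simp_rw [Finset.sum_mul, mul_assoc]
    rw [integral_finsetSum _ fun i _ =>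
      ((memLp_top_mul (hk i) (memLp_top_exp hw)).integrable le_top).const_mul _, Finset.sum_div]
    refine Finset.sum_congr rfl fun i _ => ?_
    rw [integral_const_mul, mul_div_assoc]
  rw [hlin] at hJ
  have hterm : ∀ i, a i * κ i - a i * ((∫ x, k i x * Real.exp (inner ℝ u (T x)) ∂μ) / W)
      ≤ β / 2 * |a i| := fun i => by
    have h1 := abs_tilted_mean_sub_mean_le hw (hk i) (abs_inner_le_of_ae_norm_le hB hu) (hk0 i)
    have h2 : (Real.exp (2 * (δ * B)) - 1) * ∫ x, k i x ∂μ ≤ β / 4 := by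
      refine le_trans ?_ hδF
      exact mul_le_mul_of_nonneg_left (hF i) (by
        have := Real.add_one_le_exp (2 * (δ * B)); linarith)
    have h3 : |κ i - (∫ x, k i x * Real.exp (inner ℝ u (T x)) ∂μ) / W| ≤ β / 2 := by
      have := abs_sub_le (κ i) (∫ x, k i x ∂μ)
        ((∫ x, k i x * Real.exp (inner ℝ u (T x)) ∂μ) / W)
      rw [abs_sub_comm (∫ x, k i x ∂μ)] at this
      linarith [hκ i]
    rw [← mul_sub]
    calc _ ≤ |a i * (κ i - (∫ x, k i x * Real.exp (inner ℝ u (T x)) ∂μ) / W)| := le_abs_self _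
      _ = |a i| * |κ i - (∫ x, k i x * Real.exp (inner ℝ u (T x)) ∂μ) / W| := abs_mul _ _
      _ ≤ |a i| * (β / 2) := by gcongr
      _ = _ := mul_comm _ _
  have hsum := Finset.sum_le_sum fun i (_ : i ∈ Finset.univ) => hterm i
  rw [Finset.sum_sub_distrib, ← Finset.mul_sum] at hsum
  simp only [excessLogLik, Pi.zero_apply, zero_mul, Finset.sum_const_zero, add_zero, abs_zero,
    mul_zero, sub_zero, ← Finset.mul_sum, ← hW]
  linarith

/-- Concavity spreads negativity on the sphere of radius `δ` to everything beyond it. -/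
lemma excessLogLik_neg_of_lt_norm (hβ : 0 < β) (hT : MemLp T ⊤ μ) (hk : ∀ i, MemLp (k i) ⊤ μ)
    {δ : ℝ} (hδ : 0 < δ)
    (hball : ∀ u : V, ‖u‖ ≤ δ → ∀ a, excessLogLik μ T k β τ κ u a + β / 2 * ∑ i, |a i|
      ≤ excessLogLik μ T k β τ κ u 0)
    (hsphere : ∀ u : V, ‖u‖ = δ → excessLogLik μ T k β τ κ u 0 < 0)
    {u : V} (hu : δ < ‖u‖) (a : ι → ℝ) : excessLogLik μ T k β τ κ u a < 0 := by
  have hupos : 0 < ‖u‖ := hδ.trans hu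
  set s := δ / ‖u‖ with hs
  have hs0 : 0 < s := div_pos hδ hupos
  have hs1 : s ≤ 1 := (div_le_one hupos).2 hu.le
  have hnorm : ‖s • u‖ = δ := by
    rw [norm_smul, Real.norm_of_nonneg hs0.le, hs, div_mul_cancel₀ _ hupos.ne']
  have hconc : s * excessLogLik μ T k β τ κ u a ≤ excessLogLik μ T k β τ κ (s • u) (s • a) := by
    have h := log_integral_exp_mul_le
      ((memLp_top_inner hT u).add (memLp_top_linear_combination hk a)) hs0.le hs1
    simp only [Pi.add_apply] at h
    have e1 : ∀ x, inner ℝ (s • u) (T x) + ∑ i, (s • a) i * k i x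
        = s * (inner ℝ u (T x) + ∑ i, a i * k i x) := fun x => by
      simp only [real_inner_smul_left, Pi.smul_apply, smul_eq_mul, mul_add, Finset.mul_sum,
        mul_assoc]
    have e2 : ∑ i, (s • a) i * κ i = s * ∑ i, a i * κ i := by
      simp only [Pi.smul_apply, smul_eq_mul, Finset.mul_sum, mul_assoc]
    have e3 : ∑ i, β * |(s • a) i| = s * ∑ i, β * |a i| := by
      simp only [Pi.smul_apply, smul_eq_mul, abs_mul, abs_of_pos hs0, Finset.mul_sum]
      exact Finset.sum_congr rfl fun i _ => by ring
    simp only [← e1] at h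
    simp only [excessLogLik, e2, e3]
    rw [real_inner_smul_left u τ]
    linarith
  have hpen : 0 ≤ β / 2 * ∑ i, |(s • a) i| := by positivity
  have hneg : s * excessLogLik μ T k β τ κ u a < 0 := by
    linarith [hball (s • u) hnorm.le (s • a), hsphere _ hnorm]
  exact (mul_neg_iff.1 hneg).elim (fun h => h.2) fun h => absurd h.1 hs0.not_gt

lemma excessLogLik_zero_zero : excessLogLik μ T k β τ κ 0 0 = 0 := by
  simp [excessLogLik]

lemma continuous_log_integral_exp_inner (hT : MemLp T ⊤ μ) {B : ℝ} (hB : ∀ᵐ x ∂μ, ‖T x‖ ≤ B) :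
    Continuous fun u : V => Real.log (∫ x, Real.exp (inner ℝ u (T x)) ∂μ) := by
  refine (LipschitzWith.of_le_add_mul (Real.toNNReal B) fun u v => ?_).continuous
  refine (log_integral_exp_le_add (memLp_top_inner hT u) (memLp_top_inner hT v)
    (c := dist u v * B) ?_).trans ?_
  · filter_upwards [abs_inner_le_of_ae_norm_le hB (dist_eq_norm u v).ge] with x hx
    rw [inner_sub_left] at hx
    linarith [le_of_abs_le hx]
  · rw [mul_comm]
    gcongr
    exact Real.le_coe_toNNReal B

/-- If the sample means are close to their expectations, then the penalized log-likelihood has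
maximizers, and all of them lie within `δ` of the true parameter and have zero augmented part. -/
lemma excessLogLik_maximizers [ProperSpace V] (hβ : 0 < β) (hT : MemLp T ⊤ μ) {B : ℝ}
    (hB : ∀ᵐ x ∂μ, ‖T x‖ ≤ B) (hk : ∀ i, MemLp (k i) ⊤ μ) {δ : ℝ} (hδ : 0 < δ)
    (hball : ∀ u : V, ‖u‖ ≤ δ → ∀ a, excessLogLik μ T k β τ κ u a + β / 2 * ∑ i, |a i|
      ≤ excessLogLik μ T k β τ κ u 0)
    (hsphere : ∀ u : V, ‖u‖ = δ → excessLogLik μ T k β τ κ u 0 < 0)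
    {Θ : Set V} (hΘ : IsClosed Θ) {v₀ : V} (hv₀ : v₀ ∈ Θ) :
    (∃ v ∈ Θ, ∀ v' ∈ Θ, ∀ a,
      excessLogLik μ T k β τ κ (v' - v₀) a ≤ excessLogLik μ T k β τ κ (v - v₀) 0) ∧
    ∀ v ∈ Θ, ∀ a, (∀ v' ∈ Θ, ∀ a',
      excessLogLik μ T k β τ κ (v' - v₀) a' ≤ excessLogLik μ T k β τ κ (v - v₀) a) →
      ‖v - v₀‖ ≤ δ ∧ a = 0 := by
  have h00 : excessLogLik μ T k β τ κ (v₀ - v₀) 0 = 0 := by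
    rw [sub_self, excessLogLik_zero_zero]
  have hout := fun u hu a => excessLogLik_neg_of_lt_norm (u := u) hβ hT hk hδ hball hsphere hu a
  constructor
  · have hcont : Continuous fun v => excessLogLik μ T k β τ κ (v - v₀) 0 := by
      have h := (continuous_log_integral_exp_inner hT hB).comp (continuous_id.sub
        (continuous_const (y := v₀)))
      simp only [excessLogLik, Pi.zero_apply, zero_mul, Finset.sum_const_zero, add_zero, abs_zero,
        mul_zero, sub_zero]
      exact ((continuous_id.sub continuous_const).inner continuous_const).sub h
    obtain ⟨v, hv, hmax⟩ := ((isCompact_closedBall v₀ δ).inter_right hΘ).exists_isMaxOn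
      ⟨v₀, Metric.mem_closedBall_self hδ.le, hv₀⟩ hcont.continuousOn
    refine ⟨v, hv.2, fun v' hv' a => ?_⟩
    rcases le_or_gt ‖v' - v₀‖ δ with h | h
    · have hpen : 0 ≤ β / 2 * ∑ i, |a i| := by positivity
      have h1 := hmax ⟨mem_closedBall_iff_norm.2 h, hv'⟩
      simp only [Set.mem_ofPred_eq] at h1
      linarith [hball _ h a]
    · have h1 := hmax ⟨Metric.mem_closedBall_self hδ.le, hv₀⟩
      simp only [Set.mem_ofPred_eq, h00] at h1
      exact (hout _ h a).le.trans h1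
  · intro v hv a hmax
    have hle : ‖v - v₀‖ ≤ δ := by
      by_contra hlt
      have h1 := hmax v₀ hv₀ 0
      rw [h00] at h1
      exact (hout _ (not_le.1 hlt) a).not_ge h1
    refine ⟨hle, ?_⟩
    have h1 := hmax v hv 0
    have h2 := hball _ hle a
    have h3 : ∑ i, |a i| ≤ 0 := by
      by_contra h
      have := mul_pos (half_pos hβ) (not_le.1 h)
      linarith
    funext i
    have h4 := Finset.single_le_sum (fun j _ => abs_nonneg (a j)) (Finset.mem_univ i)
    exact abs_nonpos_iff.1 (h4.trans h3)

/-- Uniform identifiability on a sphere: if no nonzero `u` makes `⟨u, T⟩` almost surely constant,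
then for every sample mean `τ` close enough to the expectation of `T` the log-likelihood ratio is
negative on the sphere of radius `δ`. -/
lemma exists_excessLogLik_neg_on_sphere [ProperSpace V] (hT : MemLp T ⊤ μ)
    {B : ℝ} (hB : ∀ᵐ x ∂μ, ‖T x‖ ≤ B)
    (hmin : ∀ u : V, (∃ c : ℝ, ∀ᵐ x ∂μ, inner ℝ u (T x) = c) → u = 0) {δ : ℝ} (hδ : 0 < δ) :
    ∃ η : ℝ, 0 < η ∧ ∀ (ι : Type) [Fintype ι] (k : ι → S → ℝ) (β : ℝ) (κ : ι → ℝ) (τ : V),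
      ‖τ - ∫ x, T x ∂μ‖ < η → ∀ u : V, ‖u‖ = δ → excessLogLik μ T k β τ κ u 0 < 0 := by
  have hmean : ∀ u : V, ∫ x, inner ℝ u (T x) ∂μ = inner ℝ u (∫ x, T x ∂μ) := fun u =>
    integral_inner (hT.integrable le_top) u
  have hcont : Continuous fun u : V =>
      Real.log (∫ x, Real.exp (inner ℝ u (T x)) ∂μ) - inner ℝ u (∫ x, T x ∂μ) :=
    (continuous_log_integral_exp_inner hT hB).sub (continuous_id.inner continuous_const)
  obtain ⟨c, hc0, hc⟩ := (isCompact_sphere (0 : V) δ).exists_forall_le' hcont.continuousOn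
    (a := 0) fun u hu => by
      rw [mem_sphere_zero_iff_norm] at hu
      by_contra hle
      have h := ae_eq_integral_of_log_integral_exp_le (memLp_top_inner hT u) (by
        rw [hmean]; linarith)
      have hu0 := hmin u ⟨_, h⟩
      rw [hu0, norm_zero] at hu
      exact hδ.ne hu
  refine ⟨c / δ, div_pos hc0 hδ, fun ι _ k β κ τ hτ u hu => ?_⟩
  have h1 := hc u (mem_sphere_zero_iff_norm.2 hu)
  have h2 : inner ℝ u τ - inner ℝ u (∫ x, T x ∂μ) < c := by
    rw [← inner_sub_right]
    calc _ ≤ ‖u‖ * ‖τ - ∫ x, T x ∂μ‖ := real_inner_le_norm _ _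
      _ < δ * (c / δ) := by rw [hu]; gcongr
      _ = c := by field_simp
  simp only [excessLogLik, Pi.zero_apply, zero_mul, Finset.sum_const_zero, add_zero, abs_zero,
    mul_zero, sub_zero]
  linarith

end Excess

/-! ### Concentration of the kernel averages -/

section Concentration

variable {Ω : Type*} [MeasurableSpace Ω] {P : Measure Ω} [IsProbabilityMeasure P]

lemma integrable_exp_mul_of_ae_abs_le {Y : Ω → ℝ} (hY : AEMeasurable Y P) {b : ℝ}
    (hb : ∀ᵐ ω ∂P, |Y ω| ≤ b) (r : ℝ) : Integrable (fun ω => Real.exp (r * Y ω)) P :=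
  (memLp_top_exp ((memLp_top_of_bound hY.aestronglyMeasurable b hb).const_mul r)).integrable le_top

lemma mgf_le_exp_of_variance_le {Y : Ω → ℝ} (hY : AEMeasurable Y P) {b v r : ℝ}
    (hb : ∀ᵐ ω ∂P, |Y ω| ≤ b) (hmean : ∫ ω, Y ω ∂P = 0) (hvar : ∫ ω, Y ω ^ 2 ∂P ≤ v)
    (hr : |r| * b ≤ 1) : mgf Y P r ≤ Real.exp (r ^ 2 * v) := by
  have hL : MemLp Y ⊤ P := memLp_top_of_bound hY.aestronglyMeasurable b hb
  have i1 : Integrable Y P := hL.integrable le_top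
  have i2 : Integrable (fun ω => Y ω ^ 2) P := by
    simpa only [sq] using (memLp_top_mul hL hL).integrable le_top
  have i3 : Integrable (fun ω => 1 + r * Y ω) P := (integrable_const 1).add (i1.const_mul r)
  calc mgf Y P r ≤ ∫ ω, ((1 + r * Y ω) + r ^ 2 * Y ω ^ 2) ∂P := by
        refine integral_mono_ae (integrable_exp_mul_of_ae_abs_le hY hb r)
          (i3.add (i2.const_mul _)) ?_
        filter_upwards [hb] with ω hω
        have h1 : |r * Y ω| ≤ 1 := by
          rw [abs_mul]
          exact (mul_le_mul_of_nonneg_left hω (abs_nonneg r)).trans hr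
        have h2 := le_of_abs_le (Real.abs_exp_sub_one_sub_id_le h1)
        rw [mul_pow] at h2
        linarith
    _ = 1 + r ^ 2 * ∫ ω, Y ω ^ 2 ∂P := by
        rw [integral_add i3 (i2.const_mul _), integral_add (integrable_const 1) (i1.const_mul r),
          integral_const_mul, integral_const_mul, hmean]
        simp
    _ ≤ 1 + r ^ 2 * v := by gcongr
    _ ≤ Real.exp (r ^ 2 * v) := by
        have := Real.add_one_le_exp (r ^ 2 * v)
        linarith

/-- Bernstein's inequality in Chernoff form. -/
lemma measureReal_abs_sum_ge_le {ι : Type*} {Y : ι → Ω → ℝ} (hindep : iIndepFun Y P)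
    (hY : ∀ i, AEMeasurable (Y i) P) {b v r : ℝ} (hb : ∀ i, ∀ᵐ ω ∂P, |Y i ω| ≤ b)
    (hmean : ∀ i, ∫ ω, Y i ω ∂P = 0) (hvar : ∀ i, ∫ ω, Y i ω ^ 2 ∂P ≤ v) (hr0 : 0 ≤ r)
    (hr : r * b ≤ 1) (s : Finset ι) (ε : ℝ) :
    P.real {ω | ε ≤ |∑ i ∈ s, Y i ω|} ≤ 2 * Real.exp (-(r * ε) + s.card * (r ^ 2 * v)) := by
  have hmgf : ∀ r', |r'| = r →
      mgf (∑ i ∈ s, Y i) P r' ≤ Real.exp (s.card * (r ^ 2 * v)) := fun r' hr' => by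
    rw [hindep.mgf_sum₀ hY, Real.exp_nat_mul]
    rw [← Finset.prod_const]
    refine Finset.prod_le_prod (fun i _ => mgf_nonneg) fun i _ => ?_
    rw [← hr', sq_abs]
    exact mgf_le_exp_of_variance_le (hY i) (hb i) (hmean i) (hvar i) (by rwa [hr'])
  have hsb : ∀ᵐ ω ∂P, |(∑ i ∈ s, Y i) ω| ≤ s.card * b := by
    filter_upwards [(s.eventually_all (l := ae P)).2 fun i _ => hb i] with ω hω
    rw [Finset.sum_apply]
    refine (Finset.abs_sum_le_sum_abs _ _).trans ?_
    simpa using Finset.sum_le_sum hω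
  have hsm : AEMeasurable (∑ i ∈ s, Y i) P := Finset.aemeasurable_sum s fun i _ => hY i
  have hU := measure_ge_le_exp_mul_mgf (X := ∑ i ∈ s, Y i) (μ := P) ε hr0
    (integrable_exp_mul_of_ae_abs_le hsm hsb r)
  have hL := measure_le_le_exp_mul_mgf (X := ∑ i ∈ s, Y i) (μ := P) (-ε) (neg_nonpos.2 hr0)
    (integrable_exp_mul_of_ae_abs_le hsm hsb (-r))
  have hsub : {ω | ε ≤ |∑ i ∈ s, Y i ω|}
      ⊆ {ω | ε ≤ (∑ i ∈ s, Y i) ω} ∪ {ω | (∑ i ∈ s, Y i) ω ≤ -ε} := fun ω hω => by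
    simp only [Finset.sum_apply, Set.mem_union, Set.mem_ofPred_eq] at hω ⊢
    rcases le_abs.1 hω with h | h
    · exact Or.inl h
    · exact Or.inr (by linarith)
  refine (measureReal_mono hsub).trans ((measureReal_union_le _ _).trans ?_)
  have h1 := hmgf r (abs_of_nonneg hr0)
  have h2 := hmgf (-r) (by rw [abs_neg, abs_of_nonneg hr0])
  have e : -(-r) * -ε = -(r * ε) := by ring
  rw [e] at hL
  rw [neg_mul] at hU
  rw [Real.exp_add]
  have h3 := mul_le_mul_of_nonneg_left h1 (Real.exp_pos (-(r * ε))).le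
  have h4 := mul_le_mul_of_nonneg_left h2 (Real.exp_pos (-(r * ε))).le
  linarith

/-- Freezing one of the variables: a tail bound for `∑ j ∈ s, g y (x j)` that is uniform in `y`
also holds with `y` replaced by an independent `x i`. -/
lemma measure_abs_sum_ge_le_of_forall {ι S : Type*} [MeasurableSpace S] {x : ι → Ω → S}
    (hindep : iIndepFun x P) (hx : ∀ i, AEMeasurable (x i) P) {g : S → S → ℝ}
    (hg : Measurable (Function.uncurry g)) {s : Finset ι} {i : ι} (hi : i ∉ s) {ε : ℝ}
    {c : ENNReal} (hc : ∀ y, P {ω | ε ≤ |∑ j ∈ s, g y (x j ω)|} ≤ c) :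
    P {ω | ε ≤ |∑ j ∈ s, g (x i ω) (x j ω)|} ≤ c := by
  have hind := (hindep.indepFun_finset₀ {i} s (Finset.disjoint_singleton_left.2 hi) hx).comp
    (measurable_pi_apply (⟨i, Finset.mem_singleton_self i⟩ : ({i} : Finset ι))) measurable_id
  have hz : AEMeasurable (fun ω (j : s) => x j ω) P := aemeasurable_pi_lambda _ fun j => hx j
  have hprod := (indepFun_iff_map_prod_eq_prod_map_map (hx i) hz).1 hind
  set A : Set (S × (s → S)) := {p | ε ≤ |∑ j, g p.1 (p.2 j)|} with hA
  have hAm : MeasurableSet A := by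
    refine measurableSet_le measurable_const ?_
    refine (Finset.measurable_sum _ fun j _ => ?_).abs
    exact hg.comp (measurable_fst.prodMk ((measurable_pi_apply j).comp measurable_snd))
  have : IsProbabilityMeasure (P.map (x i)) := Measure.isProbabilityMeasure_map (hx i)
  have e1 : P {ω | ε ≤ |∑ j ∈ s, g (x i ω) (x j ω)|}
      = (P.map fun ω => (x i ω, fun j : s => x j ω)) A := by
    rw [Measure.map_apply_of_aemeasurable ((hx i).prodMk hz) hAm]
    congr 1
    ext ω
    simp only [hA, Set.mem_preimage, Set.mem_ofPred_eq]
    rw [← Finset.sum_coe_sort s fun j => g (x i ω) (x j ω)]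
  rw [e1, hprod, Measure.prod_apply hAm]
  calc _ ≤ ∫⁻ _, c ∂(P.map (x i)) := by
        refine lintegral_mono fun y => ?_
        rw [Measure.map_apply_of_aemeasurable hz (measurable_prodMk_left hAm)]
        refine le_trans (le_of_eq ?_) (hc y)
        congr 1
        ext ω
        simp only [hA, Set.mem_preimage, Set.mem_ofPred_eq]
        rw [← Finset.sum_coe_sort s fun j => g y (x j ω)]
    _ = c := by simp

end Concentration

section KernelAverages

variable {Ω : Type*} [MeasurableSpace Ω] {P : Measure Ω} [IsProbabilityMeasure P]
  {S : Type*} [MeasurableSpace S] {μ : Measure S} [IsProbabilityMeasure μ] {x : ℕ → Ω → S}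

/-- Leave-one-out union bound for kernel averages at the sample points. The variance of
`κ y (x j)` is at most `b * F`, not only `b ^ 2`, which gives the exponent of order `n / b`. -/
lemma measure_exists_kernel_deviation_le (hindep : iIndepFun x P)
    (hlaw : ∀ i, HasLaw (x i) μ P) {κ : S → S → ℝ} (hκ : Measurable (Function.uncurry κ))
    (hκ0 : ∀ y z, 0 ≤ κ y z) {b F ε ρ : ℝ} (hb : 0 < b) (hκb : ∀ y z, κ y z ≤ b)
    (hF : ∀ y, ∫ z, κ y z ∂μ ≤ F) (hρ0 : 0 ≤ ρ) (hρ1 : ρ ≤ 1)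
    (hρF : ρ * F ≤ ε / 4) {n : ℕ} (hn : b < n * (ε / 2)) :
    P {ω | ∃ i : Fin n, ε ≤ |(n : ℝ)⁻¹ * ∑ j : Fin n, κ (x i ω) (x j ω) - ∫ z, κ (x i ω) z ∂μ|}
      ≤ ENNReal.ofReal (n * (2 * Real.exp (-(ρ * ε / 4 * (n / b))))) := by
  set φ : S → ℝ := fun y => ∫ z, κ y z ∂μ with hφ
  have hφm : Measurable φ := hκ.stronglyMeasurable.integral_prod_right.measurable
  have hκy : ∀ y, Measurable (κ y) := fun y => hκ.comp measurable_prodMk_left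
  have hκL : ∀ y, MemLp (κ y) ⊤ μ := fun y =>
    memLp_top_of_bound (hκy y).aestronglyMeasurable b (Eventually.of_forall fun z => by
      rw [Real.norm_of_nonneg (hκ0 y z)]; exact hκb y z)
  have hφ0 : ∀ y, 0 ≤ φ y := fun y => integral_nonneg (hκ0 y)
  have hφb : ∀ y, φ y ≤ b := fun y => by
    have := integral_mono ((hκL y).integrable le_top) (integrable_const b) (hκb y)
    simpa using this
  set g : S → S → ℝ := fun y z => κ y z - φ y with hgdef
  have hg : Measurable (Function.uncurry g) := hκ.sub (hφm.comp measurable_fst)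
  have hgy : ∀ y, Measurable (g y) := fun y => hg.comp measurable_prodMk_left
  have hgb : ∀ y z, |g y z| ≤ b := fun y z =>
    abs_sub_le_of_nonneg_of_le (hκ0 y z) (hκb y z) (hφ0 y) (hφb y)
  have hgmean : ∀ y, ∫ z, g y z ∂μ = 0 := fun y => by
    rw [integral_sub ((hκL y).integrable le_top) (integrable_const _)]
    simp [hφ]
  have hgvar : ∀ y, ∫ z, g y z ^ 2 ∂μ ≤ b * F := fun y => by
    have i1 : Integrable (κ y) μ := (hκL y).integrable le_top
    have i2 : Integrable (fun z => (b - 2 * φ y) * κ y z + φ y ^ 2) μ :=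
      (i1.const_mul _).add (integrable_const _)
    have hgL : MemLp (g y) ⊤ μ := memLp_top_of_bound (hgy y).aestronglyMeasurable b
      (Eventually.of_forall (hgb y))
    have i3 : Integrable (fun z => g y z ^ 2) μ := by
      simpa only [sq] using (memLp_top_mul hgL hgL).integrable le_top
    calc ∫ z, g y z ^ 2 ∂μ ≤ ∫ z, ((b - 2 * φ y) * κ y z + φ y ^ 2) ∂μ := by
          refine integral_mono i3 i2 fun z => ?_
          simp only [hgdef]
          nlinarith [hκ0 y z, hκb y z]
      _ = (b - 2 * φ y) * φ y + φ y ^ 2 := by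
          rw [integral_add (i1.const_mul _) (integrable_const _), integral_const_mul]
          simp [hφ]
      _ ≤ b * F := by nlinarith [hF y, sq_nonneg (φ y)]
  have hn0 : 0 < (n : ℝ) := by
    rcases Nat.eq_zero_or_pos n with h | h
    · subst h; simp at hn; linarith
    · exact_mod_cast h
  have hfix : ∀ (s : Finset ℕ), s.card ≤ n → ∀ y,
      P {ω | n * (ε / 2) ≤ |∑ j ∈ s, g y (x j ω)|}
        ≤ ENNReal.ofReal (2 * Real.exp (-(ρ * ε / 4 * (n / b)))) := fun s hs y => by
    have hint : ∀ (f : S → ℝ), Measurable f → ∀ j, ∫ ω, f (x j ω) ∂P = ∫ z, f z ∂μ :=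
      fun f hf j => by
        rw [← (hlaw j).map_eq, integral_map (hlaw j).aemeasurable hf.aestronglyMeasurable]
    have h := measureReal_abs_sum_ge_le (P := P) (Y := fun j ω => g y (x j ω)) (b := b)
      (v := b * F) (r := ρ / b)
      (hindep.comp (fun _ => g y) fun _ => hgy y)
      (fun j => (hgy y).comp_aemeasurable (hlaw j).aemeasurable)
      (fun j => Eventually.of_forall fun ω => hgb y _)
      (fun j => (hint (g y) (hgy y) j).trans (hgmean y))
      (fun j => (hint (fun z => g y z ^ 2) ((hgy y).pow_const 2) j).le.trans (hgvar y))
      (by positivity) (by rw [div_mul_cancel₀ _ hb.ne']; exact hρ1) s (n * (ε / 2))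
    rw [← ofReal_measureReal]
    refine ENNReal.ofReal_le_ofReal (h.trans ?_)
    have hF0 : 0 ≤ F := (hφ0 y).trans (hF y)
    have hs' : (s.card : ℝ) ≤ n := by exact_mod_cast hs
    have h1 : (s.card : ℝ) * ((ρ / b) ^ 2 * (b * F)) ≤ n * ((ρ / b) ^ 2 * (b * F)) := by gcongr
    have h2 : n * ((ρ / b) ^ 2 * (b * F)) = n / b * ρ * (ρ * F) := by field_simp
    have h3 : n / b * ρ * (ρ * F) ≤ n / b * ρ * (ε / 4) := by gcongr
    have h4 : ρ / b * (n * (ε / 2)) = n / b * ρ * (ε / 2) := by ring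
    have h5 : -(ρ / b * (n * (ε / 2))) + s.card * ((ρ / b) ^ 2 * (b * F))
        ≤ -(ρ * ε / 4 * (n / b)) := by
      rw [h4]; linarith
    have := Real.exp_le_exp.2 h5
    linarith
  have hsub : {ω | ∃ i : Fin n,
        ε ≤ |(n : ℝ)⁻¹ * ∑ j : Fin n, κ (x i ω) (x j ω) - ∫ z, κ (x i ω) z ∂μ|}
      ⊆ ⋃ i ∈ Finset.range n,
        {ω | n * (ε / 2) ≤ |∑ j ∈ (Finset.range n).erase i, g (x i ω) (x j ω)|} := by
    rintro ω ⟨i, hi⟩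
    simp only [Set.mem_iUnion]
    refine ⟨i, Finset.mem_range.2 i.2, ?_⟩
    have e1 : (n : ℝ)⁻¹ * ∑ j : Fin n, κ (x i ω) (x j ω) - ∫ z, κ (x i ω) z ∂μ
        = (n : ℝ)⁻¹ * ∑ j ∈ Finset.range n, g (x i ω) (x j ω) := by
      rw [Fin.sum_univ_eq_sum_range fun j => κ (x i ω) (x j ω)]
      simp only [hgdef, Finset.sum_sub_distrib, Finset.sum_const, Finset.card_range, nsmul_eq_mul,
        mul_sub]
      rw [← mul_assoc, inv_mul_cancel₀ hn0.ne', one_mul]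
    rw [e1, ← Finset.add_sum_erase _ _ (Finset.mem_range.2 i.2), abs_mul,
      abs_of_pos (inv_pos.2 hn0), inv_mul_eq_div, le_div_iff₀ hn0] at hi
    have h1 := hi.trans (abs_add_le _ _)
    have h2 := hgb (x i ω) (x i ω)
    simp only [Set.mem_ofPred_eq]
    linarith
  refine (measure_mono hsub).trans ((measure_biUnion_finset_le _ _).trans ?_)
  calc _ ≤ ∑ _i ∈ Finset.range n,
        ENNReal.ofReal (2 * Real.exp (-(ρ * ε / 4 * (n / b)))) := by
        refine Finset.sum_le_sum fun i _ => ?_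
        refine measure_abs_sum_ge_le_of_forall hindep (fun j => (hlaw j).aemeasurable) hg
          (Finset.notMem_erase i _) (hfix _ ?_)
        exact (Finset.card_erase_le).trans (Finset.card_range n).le
    _ = _ := by
        rw [Finset.sum_const, Finset.card_range, nsmul_eq_mul,
          ENNReal.ofReal_mul (Nat.cast_nonneg n), ENNReal.ofReal_natCast]

lemma tendsto_nat_mul_exp_neg_mul_sqrt {c : ℝ} (hc : 0 < c) :
    Tendsto (fun n : ℕ => (n : ℝ) * (2 * Real.exp (-(c * √n)))) atTop (𝓝 0) := by
  have h1 : Tendsto (fun n : ℕ => c * √(n : ℝ)) atTop atTop :=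
    (Real.tendsto_sqrt_atTop.comp tendsto_natCast_atTop_atTop).const_mul_atTop hc
  have h2 := ((Real.tendsto_pow_mul_exp_neg_atTop_nhds_zero 2).comp h1).const_mul (2 / c ^ 2)
  rw [mul_zero] at h2
  refine h2.congr fun n => ?_
  simp only [Function.comp_apply, mul_pow, Real.sq_sqrt (Nat.cast_nonneg n)]
  field_simp

/-- Kernel averages are uniformly consistent at the sample points, provided that the kernels are
bounded by a multiple of `√n` and their means stay bounded. -/
lemma tendsto_measure_exists_kernel_deviation (hindep : iIndepFun x P)
    (hlaw : ∀ i, HasLaw (x i) μ P) {κ : ℕ → S → S → ℝ}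
    (hκ : ∀ n, Measurable (Function.uncurry (κ n))) (hκ0 : ∀ n y z, 0 ≤ κ n y z) {B F : ℝ}
    (hB : 0 < B) (hκb : ∀ᶠ n in atTop, ∀ y z, κ n y z ≤ B * √n) (hF0 : 0 ≤ F)
    (hF : ∀ n y, ∫ z, κ n y z ∂μ ≤ F) {ε : ℝ} (hε : 0 < ε) :
    Tendsto (fun n : ℕ => P {ω | ∃ i : Fin n,
      ε ≤ |(n : ℝ)⁻¹ * ∑ j : Fin n, κ n (x i ω) (x j ω) - ∫ z, κ n (x i ω) z ∂μ|})
      atTop (𝓝 0) := by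
  set ρ := min 1 (ε / (4 * (F + 1))) with hρ
  have hρ0 : 0 < ρ := by positivity
  have hρF : ρ * F ≤ ε / 4 := by
    calc ρ * F ≤ ε / (4 * (F + 1)) * (F + 1) := by
          gcongr
          · exact min_le_right _ _
          · linarith
      _ = ε / 4 := by field_simp
  have hlim := ENNReal.tendsto_ofReal
    (tendsto_nat_mul_exp_neg_mul_sqrt (c := ρ * ε / 4 / B) (by positivity))
  rw [ENNReal.ofReal_zero] at hlim
  refine tendsto_of_tendsto_of_tendsto_of_le_of_le' tendsto_const_nhds hlim
    (Eventually.of_forall fun _ => zero_le) ?_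
  have hlarge : ∀ᶠ n : ℕ in atTop, 2 * B / ε < √(n : ℝ) :=
    (Real.tendsto_sqrt_atTop.comp tendsto_natCast_atTop_atTop).eventually_gt_atTop _
  filter_upwards [hκb, hlarge] with n hn hn'
  have hs : 0 < √(n : ℝ) := lt_of_le_of_lt (by positivity) hn'
  have hsq : √(n : ℝ) * √n = n := Real.mul_self_sqrt (Nat.cast_nonneg n)
  have hbn : B * √n < n * (ε / 2) := by
    rw [div_lt_iff₀ hε] at hn'
    calc B * √n = 2 * B * √n / 2 := by ring
      _ < √n * ε * √n / 2 := by gcongr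
      _ = √n * √n * (ε / 2) := by ring
      _ = n * (ε / 2) := by rw [hsq]
  refine (measure_exists_kernel_deviation_le hindep hlaw (hκ n) (hκ0 n) (by positivity) hn (hF n)
    hρ0.le (min_le_left _ _) hρF hbn).trans (le_of_eq ?_)
  have e : (n : ℝ) / (B * √n) = √n / B := by
    rw [div_eq_div_iff (by positivity) hB.ne']
    nlinarith
  rw [e]
  congr 5
  ring

end KernelAverages

/-! ### The scaled kernels -/

section ScaledKernel

variable {m : ℕ} {K : E m → ℝ}

lemma detH_eq (h : ℝ) : detH m h = (h ^ m) ^ 2 := by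
  simp [detH, ← pow_mul, mul_comm]

lemma scaledKernel_eq {h : ℝ} (hh : 0 < h) (x y : E m) :
    scaledKernel K h x y = (h ^ m)⁻¹ * K (h⁻¹ • (x - y)) := by
  rw [scaledKernel, detH_eq, Real.sqrt_sq (by positivity)]

lemma scaledKernel_nonneg (hK : IsKernel K) (h : ℝ) (x y : E m) : 0 ≤ scaledKernel K h x y :=
  mul_nonneg (inv_nonneg.2 (Real.sqrt_nonneg _)) (hK.nonneg _)

lemma measurable_uncurry_scaledKernel (hK : IsKernel K) (h : ℝ) :
    Measurable (Function.uncurry (scaledKernel K h)) := by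
  refine (hK.measurable.comp ?_).const_mul _
  exact (measurable_fst.sub measurable_snd).const_smul h⁻¹

lemma integrable_scaledKernel (hK : IsKernel K) {h : ℝ} (hh : 0 < h) (x : E m) :
    Integrable (scaledKernel K h x) := by
  have h1 : Integrable fun u : E m => K (h⁻¹ • u) := hK.integrable.comp_smul (inv_ne_zero hh.ne')
  exact (h1.comp_sub_left x).const_mul _

lemma integral_scaledKernel (hK : IsKernel K) {h : ℝ} (hh : 0 < h) (x : E m) :
    ∫ y, scaledKernel K h x y = 1 := by
  simp_rw [scaledKernel_eq hh]
  rw [integral_const_mul, integral_sub_left_eq_self (fun u : E m => K (h⁻¹ • u)) volume x,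
    Measure.integral_comp_inv_smul_of_nonneg volume K hh.le, hK.integral_eq_one]
  simp [hh.ne']

/-- If `n |H_n| → ∞`, then the kernels are eventually bounded by a multiple of `√n`. -/
lemma eventually_scaledKernel_le {h : ℕ → ℝ} (hpos : ∀ n, 0 < h n)
    (hlim : Tendsto (fun n : ℕ => n * detH m (h n)) atTop atTop) {B : ℝ} (hB0 : 0 ≤ B)
    (hB : ∀ u, K u ≤ B) :
    ∀ᶠ n : ℕ in atTop, ∀ x y, scaledKernel K (h n) x y ≤ B * √n := by
  filter_upwards [hlim.eventually_ge_atTop 1] with n hn x y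
  have hp : 0 < h n ^ m := pow_pos (hpos n) m
  rw [detH_eq] at hn
  have h1 : 1 ≤ √n * h n ^ m := by
    rw [← Real.sqrt_sq hp.le, ← Real.sqrt_mul (Nat.cast_nonneg n)]
    exact Real.one_le_sqrt.2 hn
  have h2 : (h n ^ m)⁻¹ ≤ √n := by
    rw [inv_le_iff_one_le_mul₀ hp]
    exact h1
  rw [scaledKernel_eq (hpos n), mul_comm]
  exact mul_le_mul (hB _) h2 (by positivity) hB0

lemma tendsto_nat_mul_detH {h : ℕ → ℝ}
    (hsum : Summable (fun n : ℕ => Real.exp (-1 * n * detH m (h n)))) :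
    Tendsto (fun n : ℕ => n * detH m (h n)) atTop atTop := by
  have h1 := hsum.tendsto_atTop_zero
  have h2 := tendsto_neg_atBot_atTop.comp (Real.tendsto_exp_comp_nhds_zero.1 h1)
  refine h2.congr fun n => ?_
  simp

end ScaledKernel

/-! ### The law of the sample and the partition functions -/

section Law

variable {m d : ℕ} {X : Set (E m)} {q : E m → ℝ} {t : E m → E d} {lam : E d}

lemma densityEF_nonneg (hq : ∀ x ∈ X, 0 ≤ q x) (hX : MeasurableSet X) {x : E m} (hx : x ∈ X) :
    0 ≤ densityEF X q t lam x := by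
  refine div_nonneg (mul_nonneg (hq x hx) (Real.exp_pos _).le) ?_
  exact setIntegral_nonneg hX fun y hy => mul_nonneg (hq y hy) (Real.exp_pos _).le

lemma integrableOn_densityEF (hlam : lam ∈ canonicalSpace X q t) :
    IntegrableOn (densityEF X q t lam) X :=
  Integrable.div_const hlam _

lemma lawEF_eq_zero_of_partitionEF_eq_zero (hZ : partitionEF X q t lam = 0) :
    lawEF X q t lam = 0 := by
  simp [lawEF, densityEF, hZ]

lemma partitionEF_pos (hq : ∀ x ∈ X, 0 ≤ q x) (hX : MeasurableSet X)
    [IsProbabilityMeasure (lawEF X q t lam)] : 0 < partitionEF X q t lam := by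
  refine lt_of_le_of_ne
    (setIntegral_nonneg hX fun y hy => mul_nonneg (hq y hy) (Real.exp_pos _).le) fun h => ?_
  exact IsProbabilityMeasure.ne_zero (lawEF X q t lam)
    (lawEF_eq_zero_of_partitionEF_eq_zero h.symm)

lemma lawEF_absolutelyContinuous : lawEF X q t lam ≪ volume.restrict X :=
  withDensity_absolutelyContinuous _ _

lemma ae_lawEF_mem (hX : MeasurableSet X) : ∀ᵐ x ∂lawEF X q t lam, x ∈ X :=
  lawEF_absolutelyContinuous.ae_le (ae_restrict_mem hX)

lemma integral_lawEF (hq : ∀ x ∈ X, 0 ≤ q x) (hX : MeasurableSet X)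
    (hlam : lam ∈ canonicalSpace X q t) (g : E m → ℝ) :
    ∫ x, g x ∂lawEF X q t lam = ∫ x in X, densityEF X q t lam x * g x := by
  rw [lawEF, integral_withDensity_eq_integral_toReal_smul₀
    (integrableOn_densityEF hlam).aemeasurable.ennreal_ofReal
    (Eventually.of_forall fun _ => ENNReal.ofReal_lt_top)]
  refine setIntegral_congr_fun hX fun x hx => ?_
  simp only [smul_eq_mul]
  rw [ENNReal.toReal_ofReal (densityEF_nonneg hq hX hx)]

lemma integral_lawEF_le (hq : ∀ x ∈ X, 0 ≤ q x) (hX : MeasurableSet X)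
    (hlam : lam ∈ canonicalSpace X q t) {F : ℝ} (hF0 : 0 ≤ F)
    (hF : ∀ x ∈ X, densityEF X q t lam x ≤ F) {g : E m → ℝ} (hg0 : ∀ x, 0 ≤ g x)
    (hg : Integrable g) : ∫ x, g x ∂lawEF X q t lam ≤ F * ∫ x, g x := by
  rw [integral_lawEF hq hX hlam]
  calc ∫ x in X, densityEF X q t lam x * g x ≤ ∫ x in X, F * g x := by
        refine integral_mono_of_nonneg ?_ (hg.integrableOn.const_mul F) ?_
        · filter_upwards [ae_restrict_mem hX] with x hx
          exact mul_nonneg (densityEF_nonneg hq hX hx) (hg0 x)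
        · filter_upwards [ae_restrict_mem hX] with x hx
          exact mul_le_mul_of_nonneg_right (hF x hx) (hg0 x)
    _ = F * ∫ x in X, g x := integral_const_mul _ _
    _ ≤ F * ∫ x, g x := by
        exact mul_le_mul_of_nonneg_left
          (setIntegral_le_integral hg (Eventually.of_forall hg0)) hF0

lemma exists_densityEF_le (hX : IsCompact X) (hcont : ContinuousOn (densityEF X q t lam) X) :
    ∃ F : ℝ, 0 ≤ F ∧ ∀ x ∈ X, densityEF X q t lam x ≤ F := by
  obtain ⟨F, hF⟩ := hX.exists_bound_of_continuousOn hcont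
  exact ⟨max F 0, le_max_right _ _, fun x hx =>
    (le_abs_self _).trans ((hF x hx).trans (le_max_left _ _))⟩

/-- Minimality of the family, expressed through the law of the sample: the law has the same
null sets as `q(x) dx` on `X`. -/
lemma IsMinimal.eq_zero_of_ae_lawEF (hmin : IsMinimal X q t)
    (hX : MeasurableSet X) (ht : ContinuousOn t X) (hlam : lam ∈ canonicalSpace X q t)
    (hZ : 0 < partitionEF X q t lam) (u : E d)
    (hu : ∃ c : ℝ, ∀ᵐ x ∂lawEF X q t lam, inner ℝ u (t x) = c) : u = 0 := by
  obtain ⟨c, hc⟩ := hu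
  refine hmin u ⟨c, ?_⟩
  have hqm : AEMeasurable q (volume.restrict X) := by
    have h1 : AEMeasurable (fun x => Real.exp (-inner ℝ lam (t x))) (volume.restrict X) :=
      ((Real.continuous_exp.comp continuous_neg).comp_continuousOn
        (continuousOn_const.inner ht)).aemeasurable hX
    have h2 : IntegrableOn (fun x => q x * Real.exp (inner ℝ lam (t x))) X := hlam
    refine (h2.aemeasurable.mul h1).congr
      (Eventually.of_forall fun x => ?_)
    simp only [Pi.mul_apply]
    rw [mul_assoc, ← Real.exp_add, add_neg_cancel, Real.exp_zero, mul_one]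
  rw [lawEF, ae_withDensity_iff' (integrableOn_densityEF hlam).aemeasurable.ennreal_ofReal] at hc
  rw [ae_withDensity_iff' hqm.ennreal_ofReal]
  filter_upwards [hc] with x hx hqx
  refine hx ?_
  rw [Ne, ENNReal.ofReal_eq_zero, not_le] at hqx ⊢
  exact div_pos (mul_pos hqx (Real.exp_pos _)) hZ

lemma aestronglyMeasurable_lawEF (hX : MeasurableSet X) (ht : ContinuousOn t X) :
    AEStronglyMeasurable t (lawEF X q t lam) :=
  (ht.aestronglyMeasurable hX).mono_ac lawEF_absolutelyContinuous

lemma partitionNEF_eq {n : ℕ} (hq : ∀ x ∈ X, 0 ≤ q x) (hX : MeasurableSet X)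
    (hlam : lam ∈ canonicalSpace X q t) (hZ : 0 < partitionEF X q t lam) (K : E m → ℝ) (h : ℝ)
    (xs : Fin n → E m) (θ : E d × (Fin n → ℝ)) :
    partitionNEF X q t K h xs θ = partitionEF X q t lam *
      ∫ x, Real.exp (inner ℝ (θ.1 - lam) (t x) + ∑ i, θ.2 i * scaledKernel K h (xs i) x)
        ∂lawEF X q t lam := by
  rw [integral_lawEF hq hX hlam, ← integral_const_mul, partitionNEF]
  congr 1
  funext x
  rw [densityEF, augmentedExponent, inner_sub_left, sub_add_eq_add_sub, Real.exp_sub]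
  have := (Real.exp_pos (inner ℝ lam (t x))).ne'
  field_simp

/-- The penalized log-likelihood is, up to an additive constant, the excess log-likelihood over
the true parameter. -/
lemma penalizedLogLik_eq {n : ℕ} (hq : ∀ x ∈ X, 0 ≤ q x) (hX : MeasurableSet X)
    (hlam : lam ∈ canonicalSpace X q t) (hZ : 0 < partitionEF X q t lam)
    [IsProbabilityMeasure (lawEF X q t lam)] (K : E m → ℝ) (h β : ℝ) (xs : Fin n → E m)
    (hT : MemLp t ⊤ (lawEF X q t lam))
    (hk : ∀ i, MemLp (scaledKernel K h (xs i)) ⊤ (lawEF X q t lam)) (θ : E d × (Fin n → ℝ)) :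
    penalizedLogLik X q t K h β xs θ
      = (inner ℝ lam ((n : ℝ)⁻¹ • ∑ j, t (xs j)) - Real.log (partitionEF X q t lam))
        + excessLogLik (lawEF X q t lam) t (fun i => scaledKernel K h (xs i)) β
          ((n : ℝ)⁻¹ • ∑ j, t (xs j))
          (fun i => (n : ℝ)⁻¹ * ∑ j, scaledKernel K h (xs i) (xs j)) (θ.1 - lam) θ.2 := by
  have hpos := integral_exp_pos_of_memLp_top
    ((memLp_top_inner hT (θ.1 - lam)).add (memLp_top_linear_combination hk θ.2))
  simp only [Pi.add_apply] at hpos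
  have e1 : (n : ℝ)⁻¹ * ∑ j, augmentedExponent t K h xs θ (xs j)
      = inner ℝ θ.1 ((n : ℝ)⁻¹ • ∑ j, t (xs j))
        + ∑ i, θ.2 i * ((n : ℝ)⁻¹ * ∑ j, scaledKernel K h (xs i) (xs j)) := by
    simp only [augmentedExponent, Finset.sum_add_distrib, mul_add, inner_smul_right, inner_sum]
    congr 1
    rw [Finset.sum_comm, Finset.mul_sum]
    refine Finset.sum_congr rfl fun i _ => ?_
    rw [← Finset.mul_sum]
    ring
  rw [penalizedLogLik, partitionNEF_eq hq hX hlam hZ, Real.log_mul hZ.ne' hpos.ne', e1,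
    excessLogLik, inner_sub_left]
  ring

end Law

/-! ### Consistency -/

/-- The weak law of large numbers for a statistic that is continuous on the support only. -/
lemma tendsto_measure_sample_mean {Ω : Type*} [MeasurableSpace Ω] {P : Measure Ω}
    [IsProbabilityMeasure P] {S V : Type*} [MeasurableSpace S] {μ : Measure S}
    [NormedAddCommGroup V] [NormedSpace ℝ V] [CompleteSpace V] [MeasurableSpace V] [BorelSpace V]
    {x : ℕ → Ω → S} (hindep : iIndepFun x P) (hlaw : ∀ i, HasLaw (x i) μ P) {t : S → V}
    (ht : Integrable t μ) {η : ℝ} (hη : 0 < η) :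
    Tendsto (fun n : ℕ => P {ω | η ≤ ‖(n : ℝ)⁻¹ • ∑ j : Fin n, t (x j ω) - ∫ z, t z ∂μ‖})
      atTop (𝓝 0) := by
  obtain ⟨t', hm, htt'⟩ := ht.1
  have hint' : Integrable t' μ := ht.congr htt'
  have hx := fun i => (hlaw i).aemeasurable
  have hint : ∀ i, Integrable (t' ∘ x i) P := fun i => by
    have h := hint'
    rw [← (hlaw i).map_eq] at h
    exact h.comp_aemeasurable (hx i)
  have hae : ∀ᵐ ω ∂P, ∀ j, t (x j ω) = t' (x j ω) := ae_all_iff.2 fun j => by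
    have h := htt'
    rw [← (hlaw j).map_eq] at h
    exact ae_of_ae_map (hx j) h
  have hmean : ∫ ω, t' (x 0 ω) ∂P = ∫ z, t z ∂μ := by
    rw [integral_congr_ae htt', ← (hlaw 0).map_eq,
      integral_map (hx 0) hm.aestronglyMeasurable]
  have hlln := strong_law_ae (μ := P) (fun i => t' ∘ x i) (hint 0)
    (fun i j hij => (hindep.indepFun hij).comp hm.measurable hm.measurable)
    (fun i => (IdentDistrib.mk (hx i) (hx 0)
      ((hlaw i).map_eq.trans (hlaw 0).map_eq.symm)).comp hm.measurable)
  have hlim : ∀ᵐ ω ∂P, Tendsto (fun n : ℕ => (n : ℝ)⁻¹ • ∑ j : Fin n, t (x j ω)) atTop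
      (𝓝 (∫ z, t z ∂μ)) := by
    filter_upwards [hlln, hae] with ω h1 h2
    rw [← hmean]
    refine h1.congr fun n => ?_
    rw [Fin.sum_univ_eq_sum_range (fun j => t (x j ω)) n]
    simp only [Function.comp_apply, h2]
  have hmeas : ∀ n : ℕ, AEStronglyMeasurable (fun ω => (n : ℝ)⁻¹ • ∑ j : Fin n, t (x j ω)) P :=
    fun n => by
      refine AEStronglyMeasurable.const_smul (Finset.aestronglyMeasurable_fun_sum _ fun j _ => ?_) _
      exact (hint j).1.congr (hae.mono fun ω h => (h j).symm)
  exact tendstoInMeasure_iff_norm.1 (tendstoInMeasure_of_tendsto_ae hmeas hlim) η hη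

end NPEF

theorem theorem1 {m d : ℕ}
    -- the exponential family: support, base measure, statistics, canonical parameters
    (X : Set (NPEF.E m)) (hX : IsCompact X)
    (q : NPEF.E m → ℝ) (hq : ∀ x ∈ X, 0 ≤ q x)
    (t : NPEF.E m → NPEF.E d) (ht : ContinuousOn t X)
    (hmin : NPEF.IsMinimal X q t)
    (C : Set (NPEF.E d)) (hC : C ⊆ NPEF.canonicalSpace X q t)
    (hequi : UniformEquicontinuousOn (fun lam : C => NPEF.densityEF X q t (lam : NPEF.E d)) X)
    -- the set over which the canonical parameters are estimated
    (Θ : Set (NPEF.E d)) (hΘ : IsClosed Θ) (hCΘ : C ⊆ Θ)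
    -- kernel and bandwidths
    (K : NPEF.E m → ℝ) (hK : NPEF.IsKernel K) (hKV : NPEF.HasBoundedVariation K)
    (h : ℕ → ℝ) (hpos : ∀ n, 0 < h n)
    (hsum : ∀ γ : ℝ, 0 < γ → Summable (fun n : ℕ => Real.exp (-γ * n * NPEF.detH m (h n))))
    -- box width
    (β : ℝ) (hβ : 0 < β)
    -- i.i.d. sample from the true density
    {Ω : Type*} [MeasurableSpace Ω] (P : Measure Ω) [IsProbabilityMeasure P]
    (lam : NPEF.E d) (hlam : lam ∈ C)
    (x : ℕ → Ω → NPEF.E m) (hindep : iIndepFun x P)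
    (hlaw : ∀ i, HasLaw (x i) (NPEF.lawEF X q t lam) P)
    -- the estimator: a maximizer whenever there is one
    (θhat : (n : ℕ) → Ω → NPEF.E d × (Fin n → ℝ))
    (hθ : ∀ n ω,
      (∃ θ, NPEF.IsPenalizedMLE X q t K (h n) β Θ (fun i : Fin n => x i ω) θ) →
        NPEF.IsPenalizedMLE X q t K (h n) β Θ (fun i : Fin n => x i ω) (θhat n ω)) :
    (∀ ε : ℝ, 0 < ε →
      Tendsto (fun n => P {ω | ∃ i : Fin n, ε ≤ |(θhat n ω).2 i|}) atTop (𝓝 0)) ∧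
    TendstoInMeasure P (fun n ω => (θhat n ω).1) atTop (fun _ => lam) := by
  have hXm := hX.measurableSet
  have hlamC := hC hlam
  have hprob : IsProbabilityMeasure (NPEF.lawEF X q t lam) := by
    rw [← (hlaw 0).map_eq]
    exact Measure.isProbabilityMeasure_map (hlaw 0).aemeasurable
  have hZ := NPEF.partitionEF_pos (lam := lam) (t := t) hq hXm
  obtain ⟨F, hF0, hF⟩ := NPEF.exists_densityEF_le hX
    (hequi.uniformContinuousOn ⟨lam, hlam⟩).continuousOn
  obtain ⟨B₀, hB₀⟩ := hX.exists_bound_of_continuousOn ht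
  set B := max B₀ 0 with hBdef
  have hB0 : 0 ≤ B := le_max_right _ _
  have hB : ∀ᵐ z ∂NPEF.lawEF X q t lam, ‖t z‖ ≤ B :=
    (NPEF.ae_lawEF_mem hXm).mono fun z hz => (hB₀ z hz).trans (le_max_left _ _)
  have hT : MemLp t ⊤ (NPEF.lawEF X q t lam) :=
    memLp_top_of_bound (NPEF.aestronglyMeasurable_lawEF hXm ht) B hB
  obtain ⟨A₀, hA₀⟩ := hK.bounded
  set A := max A₀ 1 with hAdef
  have hA0 : 0 < A := lt_max_of_lt_right one_pos
  have hA : ∀ u, K u ≤ A := fun u => (hA₀ u).trans (le_max_left _ _)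
  have hκm := fun n => NPEF.measurable_uncurry_scaledKernel hK (h n)
  have hk : ∀ n y, MemLp (NPEF.scaledKernel K (h n) y) ⊤ (NPEF.lawEF X q t lam) := fun n y => by
    refine memLp_top_of_bound ((hκm n).comp measurable_prodMk_left).aestronglyMeasurable
      ((h n ^ m)⁻¹ * A) (Eventually.of_forall fun z => ?_)
    rw [Real.norm_of_nonneg (NPEF.scaledKernel_nonneg hK _ _ _), NPEF.scaledKernel_eq (hpos n)]
    exact mul_le_mul_of_nonneg_left (hA _) (inv_nonneg.2 (pow_pos (hpos n) m).le)
  have hkF : ∀ n y, ∫ z, NPEF.scaledKernel K (h n) y z ∂NPEF.lawEF X q t lam ≤ F := fun n y => by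
    have h1 := NPEF.integral_lawEF_le hq hXm hlamC hF0 hF (NPEF.scaledKernel_nonneg hK (h n) y)
      (NPEF.integrable_scaledKernel hK (hpos n) y)
    rwa [NPEF.integral_scaledKernel hK (hpos n), mul_one] at h1
  have hdev := NPEF.tendsto_measure_exists_kernel_deviation hindep hlaw hκm
    (fun n => NPEF.scaledKernel_nonneg hK (h n)) hA0
    (NPEF.eventually_scaledKernel_le hpos (NPEF.tendsto_nat_mul_detH (hsum 1 one_pos)) hA0.le hA)
    hF0 hkF (ε := β / 4) (by positivity)
  -- With probability tending to one the maximizers exist, and they all have zero augmented part and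
  -- canonical part within `ε` of `lam`.
  have key : ∀ ε : ℝ, 0 < ε →
      Tendsto (fun n => P {ω | ¬ (‖(θhat n ω).1 - lam‖ < ε ∧ (θhat n ω).2 = 0)}) atTop (𝓝 0) := by
    intro ε hε
    -- `δ` is so small that tilting by `⟨u, t⟩` with `‖u‖ ≤ δ` moves kernel means by at most `β / 4`.
    obtain ⟨δ, hδF, hδε, hδ⟩ : ∃ δ : ℝ,
        (Real.exp (2 * (δ * B)) - 1) * F < β / 4 ∧ δ < ε ∧ 0 < δ := by
      have hc : Tendsto (fun δ : ℝ => (Real.exp (2 * (δ * B)) - 1) * F) (𝓝[>] 0) (𝓝 0) := by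
        have h1 : Continuous fun δ : ℝ => (Real.exp (2 * (δ * B)) - 1) * F := by fun_prop
        simpa using (h1.tendsto 0).mono_left nhdsWithin_le_nhds
      exact ((hc.eventually_lt_const (by positivity)).and
        ((eventually_lt_nhds hε).filter_mono nhdsWithin_le_nhds |>.and
          self_mem_nhdsWithin)).exists
    obtain ⟨η, hη, hsph⟩ := NPEF.exists_excessLogLik_neg_on_sphere hT hB
      (hmin.eq_zero_of_ae_lawEF hXm ht hlamC hZ) hδ
    have hmean := NPEF.tendsto_measure_sample_mean hindep hlaw (hT.integrable le_top) hη
    have hsum0 := hdev.add hmean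
    rw [add_zero] at hsum0
    refine tendsto_of_tendsto_of_tendsto_of_le_of_le tendsto_const_nhds hsum0
      (fun _ => zero_le) fun n => (measure_mono ?_).trans (measure_union_le _ _)
    -- Outside the two exceptional events the estimator behaves as claimed.
    intro ω hω
    by_contra hgood
    refine hω ?_
    simp only [Set.mem_union, Set.mem_ofPred_eq, not_or, not_exists, not_le] at hgood
    obtain ⟨hg1, hg2⟩ := hgood
    have hball := fun u hu a => NPEF.excessLogLik_add_le (u := u)
      (τ := (n : ℝ)⁻¹ • ∑ j : Fin n, t (x j ω)) hT hB (fun i : Fin n => hk n (x i ω))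
      (fun i => Eventually.of_forall (NPEF.scaledKernel_nonneg hK _ _)) (fun i => hkF n _)
      (by positivity) hδF.le (fun i => (hg1 i).le) hu a
    obtain ⟨⟨v, hv, hvmax⟩, huniq⟩ := NPEF.excessLogLik_maximizers hβ hT hB
      (fun i : Fin n => hk n (x i ω)) hδ hball
      (hsph _ _ _ _ _ hg2) hΘ (hCΘ hlam)
    have hpen := NPEF.penalizedLogLik_eq hq hXm hlamC hZ K (h n) β (fun i : Fin n => x i ω) hT
      (fun i => hk n (x i ω))
    have hmle := hθ n ω ⟨(v, 0), hv, fun θ' hθ' => by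
      rw [hpen, hpen]
      exact add_le_add_right (hvmax _ hθ' _) _⟩
    have hfin := huniq _ hmle.1 (θhat n ω).2 fun v' hv' a' => by
      have h1 := hmle.2 (v', a') hv'
      rw [hpen, hpen] at h1
      exact le_of_add_le_add_left h1
    exact ⟨hfin.1.trans_lt hδε, hfin.2⟩
  refine ⟨fun ε hε => ?_, tendstoInMeasure_iff_norm.2 fun ε hε => ?_⟩
  · refine tendsto_of_tendsto_of_tendsto_of_le_of_le tendsto_const_nhds (key 1 one_pos)
      (fun _ => zero_le) fun n => measure_mono ?_
    rintro ω ⟨i, hi⟩ ⟨-, h0⟩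
    rw [h0, Pi.zero_apply, abs_zero] at hi
    exact hε.not_ge hi
  · refine tendsto_of_tendsto_of_tendsto_of_le_of_le tendsto_const_nhds (key ε hε)
      (fun _ => zero_le) fun n => measure_mono ?_
    exact fun ω hω hlt => hlt.1.not_ge hω
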